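/- Let $m\ge 1$ and $n\ge 0$ be integers, let $\Gamma=\{e,s,\dots,s^{m-1}\}$ be the cyclic group of order $m$, whose generator $s$ acts on $\mathbb{C}$ as multiplication by a fixed primitive $m$-th root of unity $\zeta$, and let $G=S_n\ltimes\Gamma^n=\mathbb{Z}_m\wr S_n$ act on $\mathfrak h=\mathbb{C}^n$. Write $s_{ij}\in S_n$ for the transpositions, $s_i$ for the copy of $s$ in the $i$-th factor of $\Gamma^n$, and put $$\mathfrak h_{\rm reg}=\Big\{x\in\mathbb{C}^n\ \Big|\ \prod_i x_i\prod_{i<j}(x_i^m-x_j^m)\neq 0\Big\},\qquad \epsilon_l=\frac1m\sum_{r=0}^{m-1}\zeta^{-lr}s^r\in\mathbb{C}\Gamma,\qquad (\epsilon_l)_i=\frac1m\sum_{r=0}^{m-1}\zeta^{-lr}s_i^r .$$ The group $G$ acts on the ring $\mathbb{C}[\mathfrak h_{\rm reg}\times\mathfrak h^*]$ of regular functions of $(x,p)$ by $(gf)(z)=f(g^{-1}z)$, and $\mathbb{C}[\mathfrak h_{\rm reg}\times\mathfrak h^*]*G$ denotes the crossed product, with multiplication $(ag)(bh)=a\,g(b)\,gh$.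 Indices of $\lambda_i$, $\kappa_l$, $\epsilon_l$, $V_i$ are taken modulo $m$. *Parameters.* Let $c=(c_{00},c_1,\dots,c_{m-1})\in\mathbb{C}^m$ be arbitrary. Put $$\lambda_0=-mc_{00}+\sum_{l=1}^{m-1}c_l,\qquad \lambda_i=\sum_{l=1}^{m-1}c_l\zeta^{-il}\quad(1\le i\le m-1),\qquad |\lambda|=\sum_{i=0}^{m-1}\lambda_i,$$ and let $\kappa_0,\dots,\kappa_{m-1}\in\mathbb{C}$ be determined by $$\sum_{r=1}^{m-1}c_rs^r=\sum_{l=0}^{m-1}m(\kappa_l-\kappa_{l-1})\epsilon_l\ \text{ in }\mathbb{C}\Gamma,\qquad \kappa_{m-1}=\sum_{r=1}^{m-1}\frac{m-r}{m^2}\lambda_r .$$ *Hamiltonians.* The classical Dunkl operators are the elements $$D_i=p_i-c_{00}\sum_{j\ne i}\sum_{r=0}^{m-1}\frac{1}{x_i-\zeta^rx_j}\,s_i^rs_{ij}s_i^{-r}-\frac1{x_i}\sum_{l=0}^{m-1}m\kappa_l(\epsilon_l)_i\qquad(1\le i\le n)$$ of $\mathbb{C}[\mathfrak h_{\rm reg}\times\mathfrak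 h^*]*G$. With $\mathbf e=\frac1{|G|}\sum_{g\in G}g$ and the linear map $\mathbf m\big(\sum_g B_g\,g\big)=\sum_g B_g$, the Calogero--Moser Hamiltonians are $$L_j(x,p)=\mathbf m\big(\mathbf e\,(D_1^{jm}+\dots+D_n^{jm})\,\mathbf e\big)\in\mathbb{C}[\mathfrak h_{\rm reg}\times\mathfrak h^*].$$ *Slice.* For $\nu=(\nu_1,\dots,\nu_n)\in\mathfrak h_{\rm reg}$ and $\mu=(\mu_1,\dots,\mu_n)\in\mathbb{C}^n$, and for $i=0,\dots,m-1$, let $Y_i$ be the $n\times n$ matrix with entries $$(Y_i)_{jj}=\mu_j+\frac1{\nu_j}\Big(a+\sum_{r=0}^i\lambda_r\Big),\quad a=-\sum_{r=0}^{m-1}\frac{m-r}{m}\lambda_r,\qquad (Y_i)_{jk}=|\lambda|\,\frac{\nu_j^{i}\nu_k^{m-i-1}}{\nu_j^m-\nu_k^m}\quad(j\neq k),$$ regarded as a map $V_{i+1}\to V_i$ between copies of $\mathbb{C}^n$, $i\in\mathbb{Z}/m\mathbb{Z}$, and let $Y=Y(\nu,\mu)=\sum_iY_i\in\mathrm{End}(V_0\oplus\dots\oplus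 V_{m-1})$, an $mn\times mn$ matrix. **Proposition.** For all $\nu\in\mathfrak h_{\rm reg}$, $\mu\in\mathbb{C}^n$ and all integers $j\ge 0$, $$\frac1m\,\mathrm{tr}\big(Y(\nu,\mu)^{jm}\big)=L_j(\nu,\mu).$$ -/

import Mathlib

noncomputable section

namespace CalogeroMoser

open Equiv

/-! The wreath product `ℤ_m ≀ S_n`, where the cyclic group `Γ = ℤ_m` is the group of complex
`m`-th roots of unity. -/

/-- The action of `S_n` on `Γ^n` by permuting the factors: `(σ a)_i = a_{σ⁻¹ i}`. -/
def permFactors (n m : ℕ) : Perm (Fin n) →* MulAut (Fin n → rootsOfUnity m ℂ) where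
  toFun σ :=
    { toFun := fun a i => a (σ⁻¹ i)
      invFun := fun a i => a (σ i)
      left_inv := fun a => by funext i; simp
      right_inv := fun a => by funext i; simp
      map_mul' := fun a b => rfl }
  map_one' := rfl
  map_mul' σ τ := rfl

/-- The group `G = Γ ≀ S_n = G(m,1,n)`. -/
abbrev WreathGroup (n m : ℕ) : Type :=
  (Fin n → rootsOfUnity m ℂ) ⋊[permFactors n m] Perm (Fin n)

instance (n m : ℕ) [NeZero m] : Finite (WreathGroup n m) :=
  Finite.of_equiv _ (SemidirectProduct.equivProd (φ := permFactors n m)).symm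

instance (n m : ℕ) [NeZero m] : Fintype (WreathGroup n m) := Fintype.ofFinite _

variable {n m : ℕ}

/-- The copy `s_i` of the element `s ∈ Γ` in the `i`-th factor of `Γ^n`. -/
def reflection (s : rootsOfUnity m ℂ) (i : Fin n) : WreathGroup n m :=
  SemidirectProduct.inl (Pi.mulSingle i s)

/-- The transposition `s_{ij} ∈ S_n`. -/
def transposition (i j : Fin n) : WreathGroup n m :=
  SemidirectProduct.inr (Equiv.swap i j)

/-! The phase space `T^* 𝔥_reg = 𝔥_reg × 𝔥^*` and its coordinate ring. -/

/-- `𝔥_reg = {x ∈ ℂ^n | ∏ x_i ∏_{i<j} (x_i^m - x_j^m) ≠ 0}`. -/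
def regularSet (n m : ℕ) : Set (Fin n → ℂ) :=
  {x | (∀ i, x i ≠ 0) ∧ ∀ i j, i ≠ j → x i ^ m ≠ x j ^ m}

/-- The phase space `𝔥_reg × 𝔥^*`: a position `x ∈ 𝔥_reg` and a momentum `p ∈ 𝔥^*`. -/
@[ext]
structure PhaseSpace (n m : ℕ) where
  x : Fin n → ℂ
  p : Fin n → ℂ
  reg : x ∈ regularSet n m

theorem rootsOfUnity_coe_pow (a : rootsOfUnity m ℂ) : (((a : ℂˣ) : ℂ)) ^ m = 1 := by
  have h := a.2
  rw [mem_rootsOfUnity] at h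
  rw [← Units.val_pow_eq_pow_val, h, Units.val_one]

/-- `G` acts on `𝔥_reg × 𝔥^*` by permuting coordinates and by
`a · (x, p) = (a_i x_i, a_i⁻¹ p_i)` for `a ∈ Γ^n` (the dual action on `𝔥^*`). -/
instance : MulAction (WreathGroup n m) (PhaseSpace n m) where
  smul g z :=
    { x := fun i => ((g.left i : ℂˣ) : ℂ) * z.x (g.right⁻¹ i)
      p := fun i => ((g.left i : ℂˣ) : ℂ)⁻¹ * z.p (g.right⁻¹ i)
      reg := by
        refine ⟨fun i => mul_ne_zero (Units.ne_zero _) (z.reg.1 _), fun i j hij => ?_⟩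
        simp only [mul_pow, rootsOfUnity_coe_pow, one_mul]
        exact z.reg.2 _ _ (fun h => hij (g.right⁻¹.injective h)) }
  one_smul z := by
    apply PhaseSpace.ext <;> funext i
    · change (((1 : WreathGroup n m).left i : ℂˣ) : ℂ) * z.x ((1 : WreathGroup n m).right⁻¹ i) = _
      simp
    · change (((1 : WreathGroup n m).left i : ℂˣ) : ℂ)⁻¹ * z.p ((1 : WreathGroup n m).right⁻¹ i) = _
      simp
  mul_smul g h z := by
    apply PhaseSpace.ext <;> funext i
    · change (((g.left * permFactors n m g.right h.left) i : ℂˣ) : ℂ) *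
          z.x ((g.right * h.right)⁻¹ i) = ((g.left i : ℂˣ) : ℂ) *
          (((h.left (g.right⁻¹ i) : ℂˣ) : ℂ) * z.x (h.right⁻¹ (g.right⁻¹ i)))
      simp [permFactors, mul_assoc]
    · change (((g.left * permFactors n m g.right h.left) i : ℂˣ) : ℂ)⁻¹ *
          z.p ((g.right * h.right)⁻¹ i) = ((g.left i : ℂˣ) : ℂ)⁻¹ *
          (((h.left (g.right⁻¹ i) : ℂˣ) : ℂ)⁻¹ * z.p (h.right⁻¹ (g.right⁻¹ i)))
      simp [permFactors, mul_assoc, mul_comm]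

theorem smul_x (g : WreathGroup n m) (z : PhaseSpace n m) (i : Fin n) :
    (g • z).x i = ((g.left i : ℂˣ) : ℂ) * z.x (g.right⁻¹ i) := rfl

theorem smul_p (g : WreathGroup n m) (z : PhaseSpace n m) (i : Fin n) :
    (g • z).p i = ((g.left i : ℂˣ) : ℂ)⁻¹ * z.p (g.right⁻¹ i) := rfl

/-- The ring `ℂ[𝔥_reg × 𝔥^*]` of regular functions: it is generated by the coordinates `x_i`, `p_i`
and the inverses of the factors `x_i` and `x_i^m - x_j^m` of the polynomial defining the
complement of `𝔥_reg`. -/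
def regularFunctions (n m : ℕ) : Subalgebra ℂ (PhaseSpace n m → ℂ) :=
  Algebra.adjoin ℂ
    ((Set.range fun i : Fin n => fun z : PhaseSpace n m => z.x i) ∪
      (Set.range fun i : Fin n => fun z : PhaseSpace n m => z.p i) ∪
      (Set.range fun i : Fin n => fun z : PhaseSpace n m => (z.x i)⁻¹) ∪
      {f | ∃ i j : Fin n, i ≠ j ∧ f = fun z : PhaseSpace n m => (z.x i ^ m - z.x j ^ m)⁻¹})

theorem x_mem (i : Fin n) : (fun z : PhaseSpace n m => z.x i) ∈ regularFunctions n m :=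
  Algebra.subset_adjoin (Or.inl (Or.inl (Or.inl ⟨i, rfl⟩)))

theorem p_mem (i : Fin n) : (fun z : PhaseSpace n m => z.p i) ∈ regularFunctions n m :=
  Algebra.subset_adjoin (Or.inl (Or.inl (Or.inr ⟨i, rfl⟩)))

theorem invX_mem (i : Fin n) : (fun z : PhaseSpace n m => (z.x i)⁻¹) ∈ regularFunctions n m :=
  Algebra.subset_adjoin (Or.inl (Or.inr ⟨i, rfl⟩))

theorem invPow_mem {i j : Fin n} (h : i ≠ j) :
    (fun z : PhaseSpace n m => (z.x i ^ m - z.x j ^ m)⁻¹) ∈ regularFunctions n m :=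
  Algebra.subset_adjoin (Or.inr ⟨i, j, h, rfl⟩)

theorem invSub_mem (s : rootsOfUnity m ℂ) (r : ℕ) {i j : Fin n} (h : i ≠ j) :
    (fun z : PhaseSpace n m => (z.x i - ((s : ℂˣ) : ℂ) ^ r * z.x j)⁻¹) ∈
      regularFunctions n m := by
  have key : (fun z : PhaseSpace n m => (z.x i - ((s : ℂˣ) : ℂ) ^ r * z.x j)⁻¹) =
      (∑ k ∈ Finset.range m, (fun z : PhaseSpace n m => z.x i) ^ k *
        ((((s : ℂˣ) : ℂ) ^ r) • (fun z : PhaseSpace n m => z.x j)) ^ (m - 1 - k)) *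
      (fun z : PhaseSpace n m => (z.x i ^ m - z.x j ^ m)⁻¹) := by
    funext z
    have hne : z.x i ^ m - z.x j ^ m ≠ 0 := sub_ne_zero.2 (z.reg.2 i j h)
    have hpow : (((s : ℂˣ) : ℂ) ^ r * z.x j) ^ m = z.x j ^ m := by
      rw [mul_pow, ← pow_mul, mul_comm r m, pow_mul, rootsOfUnity_coe_pow, one_pow, one_mul]
    have hgeom := (Commute.all (z.x i) (((s : ℂˣ) : ℂ) ^ r * z.x j)).geom_sum₂_mul m
    rw [hpow] at hgeom
    have hne' : z.x i - ((s : ℂˣ) : ℂ) ^ r * z.x j ≠ 0 := by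
      intro h0
      rw [h0, mul_zero] at hgeom
      exact hne hgeom.symm
    simp only [Pi.mul_apply, Finset.sum_apply, Pi.pow_apply, Pi.smul_apply, smul_eq_mul]
    rw [← hgeom]
    field_simp [hne']
    rw [div_self]
    intro h0
    rw [h0, zero_mul] at hgeom
    exact hne hgeom.symm
  rw [key]
  refine mul_mem (sum_mem fun k _ => mul_mem (pow_mem (x_mem i) _)
    (pow_mem (Subalgebra.smul_mem _ (x_mem j) _) _)) (invPow_mem h)

/-- Translating a regular function by an element of `G` gives a regular function. -/
theorem translate_mem (g : WreathGroup n m) {f : PhaseSpace n m → ℂ}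
    (hf : f ∈ regularFunctions n m) : (fun z => f (g • z)) ∈ regularFunctions n m := by
  induction hf using Algebra.adjoin_induction with
  | mem f hf =>
    rcases hf with ((⟨i, rfl⟩ | ⟨i, rfl⟩) | ⟨i, rfl⟩) | ⟨i, j, hij, rfl⟩
    · exact Subalgebra.smul_mem _ (x_mem (g.right⁻¹ i)) ((g.left i : ℂˣ) : ℂ)
    · exact Subalgebra.smul_mem _ (p_mem (g.right⁻¹ i)) ((g.left i : ℂˣ) : ℂ)⁻¹
    · simp only [smul_x, mul_inv]
      exact Subalgebra.smul_mem _ (invX_mem (g.right⁻¹ i)) ((g.left i : ℂˣ) : ℂ)⁻¹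
    · simp only [smul_x, mul_pow, rootsOfUnity_coe_pow, one_mul]
      exact invPow_mem (fun h => hij (g.right⁻¹.injective h))
  | algebraMap r => exact Subalgebra.algebraMap_mem _ r
  | add f₁ f₂ _ _ h₁ h₂ => exact add_mem h₁ h₂
  | mul f₁ f₂ _ _ h₁ h₂ => exact mul_mem h₁ h₂

/-- The action of `G` on `ℂ[𝔥_reg × 𝔥^*]`: `(g f)(z) = f(g⁻¹ z)`. -/
instance : MulSemiringAction (WreathGroup n m) (regularFunctions n m) where
  smul g f := ⟨fun z => f.1 (g⁻¹ • z), translate_mem g⁻¹ f.2⟩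
  one_smul f := by
    apply Subtype.ext; funext z
    change f.1 ((1 : WreathGroup n m)⁻¹ • z) = f.1 z
    rw [inv_one, one_smul]
  mul_smul g h f := by
    apply Subtype.ext; funext z
    change f.1 ((g * h)⁻¹ • z) = f.1 (h⁻¹ • g⁻¹ • z)
    rw [mul_inv_rev, mul_smul]
  smul_zero g := rfl
  smul_add g f₁ f₂ := rfl
  smul_one g := rfl
  smul_mul g f₁ f₂ := rfl

/-- The crossed product `ℂ[𝔥_reg × 𝔥^*] * G`, with multiplication `(a g)(b h) = a g(b) gh`. -/
abbrev CrossedProduct (n m : ℕ) : Type :=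
  SkewMonoidAlgebra (regularFunctions n m) (WreathGroup n m)

/-- A function as an element of the crossed product. -/
def ofFun (f : regularFunctions n m) : CrossedProduct n m := SkewMonoidAlgebra.single 1 f

/-- A group element as an element of the crossed product. -/
def ofGrp (g : WreathGroup n m) : CrossedProduct n m := SkewMonoidAlgebra.single g 1

/-- The coordinate function `p_i`. -/
def momentum (i : Fin n) : regularFunctions n m := ⟨_, p_mem i⟩

/-- The function `1 / x_i`. -/
def invX (i : Fin n) : regularFunctions n m := ⟨_, invX_mem i⟩

/-- The function `1 / (x_i - s^r x_j)`, where `i ≠ j`. -/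
def invSub (s : rootsOfUnity m ℂ) (r : ℕ) {i j : Fin n} (h : i ≠ j) : regularFunctions n m :=
  ⟨_, invSub_mem s r h⟩

/-! Idempotents, parameters and Dunkl operators. Below `s` is a generator of `Γ`, that is, a
primitive `m`-th root of unity; indices are taken modulo `m`. -/

/-- The idempotent `ε_l = (1/m) ∑_r s^{-lr} [s^r]` of the group algebra `ℂΓ`. -/
def idempotent (s : rootsOfUnity m ℂ) (l : ZMod m) : MonoidAlgebra ℂ (rootsOfUnity m ℂ) :=
  ∑ r ∈ Finset.range m,
    MonoidAlgebra.single (s ^ r) ((1 / (m : ℂ)) * (((s : ℂˣ) : ℂ) ^ (l.val * r))⁻¹)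

/-- The copy `(ε_l)_i` of `ε_l` in the `i`-th factor, as an element of the crossed product. -/
def idempotentAt (s : rootsOfUnity m ℂ) (l : ZMod m) (i : Fin n) : CrossedProduct n m :=
  ∑ r ∈ Finset.range m,
    ((1 / (m : ℂ)) * (((s : ℂˣ) : ℂ) ^ (l.val * r))⁻¹) • ofGrp (reflection s i ^ r)

/-- The classical Dunkl operator
`D_i = p_i - c₀₀ ∑_{j ≠ i} ∑_r 1/(x_i - s^r x_j) s_i^r s_{ij} s_i^{-r}
  - (1/x_i) ∑_l m κ_l (ε_l)_i`. -/
def dunkl [NeZero m] (s : rootsOfUnity m ℂ) (c₀₀ : ℂ) (κ : ZMod m → ℂ) (i : Fin n) :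
    CrossedProduct n m :=
  ofFun (momentum i)
    - c₀₀ • (∑ j : {j : Fin n // i ≠ j}, ∑ r ∈ Finset.range m,
        ofFun (invSub s r j.2) *
          ofGrp (reflection s i ^ r * transposition i j.1 * (reflection s i ^ r)⁻¹))
    - ofFun (invX i) * ∑ l : ZMod m, ((m : ℂ) * κ l) • idempotentAt s l i

/-- The symmetrising idempotent `e = (1/|G|) ∑_g g`. -/
def symmetriser [NeZero m] : CrossedProduct n m :=
  (1 / (Fintype.card (WreathGroup n m) : ℂ)) • ∑ g : WreathGroup n m, ofGrp g

/-- The linear map `∑_g B_g g ↦ ∑_g B_g`. -/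
def forgetGroup [NeZero m] (B : CrossedProduct n m) : regularFunctions n m :=
  ∑ g : WreathGroup n m, B.coeff g

/-- The `j`-th Calogero--Moser Hamiltonian
`L_j`, the image of `e (D_1^{jm} + ⋯ + D_n^{jm}) e` under `∑_g B_g g ↦ ∑_g B_g`. -/
def hamiltonian [NeZero m] (s : rootsOfUnity m ℂ) (c₀₀ : ℂ) (κ : ZMod m → ℂ) (j : ℕ) :
    regularFunctions n m :=
  forgetGroup (symmetriser * (∑ i : Fin n, dunkl s c₀₀ κ i ^ (j * m)) * symmetriser)

/-- The parameters `λ_i`, in terms of `c = (c₀₀, c_1, …, c_{m-1})`. -/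
def lam [NeZero m] (s : rootsOfUnity m ℂ) (c₀₀ : ℂ) (c : {r : ZMod m // r ≠ 0} → ℂ)
    (i : ZMod m) : ℂ :=
  if i = 0 then -(m : ℂ) * c₀₀ + ∑ r, c r
  else ∑ r, c r * (((s : ℂˣ) : ℂ) ^ (i.val * r.1.val))⁻¹

/-! The slice of the Calogero--Moser space, for arbitrary parameters `lam = (λ_i)`. -/

/-- The constant `a = -∑_r ((m - r)/m) λ_r`. -/
def shift [NeZero m] (lam : ZMod m → ℂ) : ℂ :=
  -∑ r ∈ Finset.range m, (((m : ℂ) - r) / m) * lam r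

/-- The matrix of `Y_i : V_{i+1} → V_i`, for `i = 0, …, m - 1`:
diagonal entries `μ_j + (a + λ_0 + ⋯ + λ_i) / ν_j`, off-diagonal entries
`|λ| ν_j^i ν_k^{m-i-1} / (ν_j^m - ν_k^m)`. -/
def sliceBlock [NeZero m] (lam : ZMod m → ℂ) (ν μ : Fin n → ℂ) (i : ZMod m) :
    Matrix (Fin n) (Fin n) ℂ :=
  Matrix.of fun j k =>
    if j = k then μ j + (1 / ν j) * (shift lam + ∑ r ∈ Finset.range (i.val + 1), lam r)
    else (∑ r, lam r) * (ν j ^ i.val * ν k ^ (m - i.val - 1) / (ν j ^ m - ν k ^ m))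

/-- `Y = ∑_i Y_i ∈ End(⊕_i V_i)`, where `Y_i` maps `V_{i+1}` to `V_i` and vanishes on the other
summands. Row and column indices are pairs (index of the summand, index in the summand). -/
def sliceMatrix [NeZero m] (lam : ZMod m → ℂ) (ν μ : Fin n → ℂ) :
    Matrix (ZMod m × Fin n) (ZMod m × Fin n) ℂ :=
  ∑ i : ZMod m, Matrix.of fun a b =>
    if a.1 = i ∧ b.1 = i + 1 then sliceBlock lam ν μ i a.2 b.2 else 0

end CalogeroMoser

end

/-!
The crossed product acts on the functions on `𝔥_reg × 𝔥^*`, functions by multiplication and group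
elements by translation, and `∑_g B_g g ↦ ∑_g B_g` is the evaluation `B ↦ B · 1` of this action
(`forgetGroup_eq_actOn_one`). So `L_j` is the average over `G` of `∑_i D_i^{jm} · 1`
(`evalAt_hamiltonian`).

Let `w_k = Y_{-k} ⋯ Y_{-1} (1, …, 1)`, with indices modulo `m`; its entries are functions of
`(x, p)` that are permuted by `S_n` and have weight `-k` under `Γ^n` (`blockVector_smul`). Because
of this equivariance, applying `D_i` to the `i`-th entry of `w_k` amounts to multiplying `w_k` by
the `i`-th row of a matrix whose off-diagonal entries are, up to the factor
`-c₀₀`, Fourier components of `r ↦ 1 / (x_i - s^r x_j)` and whose diagonal entries are `p_i - m κ_k / x_i`. By orthogonality of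
characters, by `|λ| = -m c₀₀` and by `a + λ_0 + ⋯ + λ_t = -m κ_{-t-1}`, this matrix is `Y_{-k-1}`.
Hence `D_i^k · 1` is the `i`-th entry of `w_k` (`evalAt_actOn_dunkl_pow`), and `∑_i D_i^{jm} · 1` is
`vᵀ Y^{jm} v`, where `v = (1, …, 1) ∈ V_0`; it is `G`-invariant, so the average changes nothing.

It remains to compare `vᵀ Y^{jm} v` with `(1/m) tr Y^{jm}` (`trace_sliceMatrix_pow`). With
`X = diag(ν) : V_i → V_{i+1}`, the moment map equation `[X, Y] = |λ| v vᵀ - ∑_i λ_i Id_{V_i}`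
(`commutator_eq`) and `tr (Y^{jm} [X, Y]) = 0` give the equality after multiplication by `|λ|`,
as the trace of `Y^{jm}` on `V_i` does not depend on `i`. If `|λ| = 0`, all blocks are diagonal and
the equality is immediate.
-/

noncomputable section

namespace CalogeroMoser

open Finset Matrix

/-! ### Roots of unity and the parameters -/

theorem sum_zmod_eq_sum_range {m : ℕ} [NeZero m] (f : ZMod m → ℂ) :
    ∑ i : ZMod m, f i = ∑ r ∈ range m, f r := by
  obtain ⟨k, rfl⟩ := Nat.exists_eq_succ_of_ne_zero (NeZero.ne m)
  rw [← Fin.sum_univ_eq_sum_range (fun r : ℕ => f r)]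
  refine Fintype.sum_congr _ _ fun i => ?_
  exact congrArg f (ZMod.natCast_zmod_val i).symm

theorem pow_eq_pow_of_cast_eq {m : ℕ} {a : ℂ} (ha : a ^ m = 1) {p q : ℕ}
    (h : (p : ZMod m) = q) : a ^ p = a ^ q := by
  rw [ZMod.natCast_eq_natCast_iff'] at h
  rw [pow_eq_pow_mod p ha, pow_eq_pow_mod q ha, h]

theorem isPrimitiveRoot_coe {m : ℕ} {s : rootsOfUnity m ℂ} (hs : IsPrimitiveRoot s m) :
    IsPrimitiveRoot ((s : ℂˣ) : ℂ) m :=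
  (IsPrimitiveRoot.coe_submonoidClass_iff.2 hs).map_of_injective (f := Units.coeHom ℂ)
    Units.val_injective

/-- Orthogonality of the characters of `ℤ_m`. -/
theorem sum_pow_mul_inv_pow {m : ℕ} [NeZero m] {ζ : ℂ} (hζ : IsPrimitiveRoot ζ m) (p q : ℕ) :
    ∑ r ∈ range m, ζ ^ (p * r) * (ζ ^ (q * r))⁻¹ =
      if (p : ZMod m) = q then (m : ℂ) else 0 := by
  have h0 : ζ ≠ 0 := hζ.ne_zero (NeZero.ne m)
  have hterm : ∀ r, ζ ^ (p * r) * (ζ ^ (q * r))⁻¹ = (ζ ^ p * (ζ ^ q)⁻¹) ^ r := fun r => by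
    rw [mul_pow, inv_pow, pow_mul, pow_mul]
  simp only [hterm]
  split_ifs with h
  · rw [pow_eq_pow_of_cast_eq hζ.pow_eq_one h, mul_inv_cancel₀ (pow_ne_zero _ h0)]
    simp
  · have hne : ζ ^ p * (ζ ^ q)⁻¹ - 1 ≠ 0 := fun h1 => h <| by
      rw [sub_eq_zero, mul_inv_eq_one₀ (pow_ne_zero _ h0)] at h1
      rw [pow_eq_pow_mod p hζ.pow_eq_one, pow_eq_pow_mod q hζ.pow_eq_one] at h1
      rw [ZMod.natCast_eq_natCast_iff']
      exact hζ.pow_inj (Nat.mod_lt _ (NeZero.pos m)) (Nat.mod_lt _ (NeZero.pos m)) h1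
    refine (mul_eq_zero.1 (geom_sum_mul (ζ ^ p * (ζ ^ q)⁻¹) m ▸ ?_ :
      (∑ r ∈ range m, (ζ ^ p * (ζ ^ q)⁻¹) ^ r) * (ζ ^ p * (ζ ^ q)⁻¹ - 1) = 0)).resolve_right hne
    rw [mul_pow, inv_pow, ← pow_mul, ← pow_mul, mul_comm p, mul_comm q, pow_mul, pow_mul,
      hζ.pow_eq_one]
    simp

/-- The Fourier component of degree `k` of the partial fractions `1 / (x - ζ^r y)`. -/
theorem sum_inv_sub_mul {m : ℕ} [NeZero m] {ζ : ℂ} (hζ : IsPrimitiveRoot ζ m) {x y : ℂ}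
    (hxy : x ^ m ≠ y ^ m) {k b : ℕ} (hb : b < m) (hbk : (b : ZMod m) = k) :
    ∑ r ∈ range m, (x - ζ ^ r * y)⁻¹ * (ζ ^ (k * r))⁻¹ =
      m * (x ^ (m - 1 - b) * y ^ b / (x ^ m - y ^ m)) := by
  have hne : x ^ m - y ^ m ≠ 0 := sub_ne_zero.2 hxy
  have hterm : ∀ r, (x - ζ ^ r * y)⁻¹ =
      (∑ a ∈ range m, x ^ (m - 1 - a) * (ζ ^ (a * r) * y ^ a)) / (x ^ m - y ^ m) := fun r => by
    have hgeom := (Commute.all (ζ ^ r * y) x).geom_sum₂_mul m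
    rw [mul_pow, ← pow_mul, mul_comm r m, pow_mul, hζ.pow_eq_one, one_pow, one_mul] at hgeom
    have hsum : ∑ a ∈ range m, x ^ (m - 1 - a) * (ζ ^ (a * r) * y ^ a) =
        ∑ a ∈ range m, (ζ ^ r * y) ^ a * x ^ (m - 1 - a) :=
      sum_congr rfl fun a _ => by rw [mul_pow, ← pow_mul, mul_comm r a]; ring
    rw [eq_div_iff hne, hsum]
    have h1 : x - ζ ^ r * y ≠ 0 := fun h0 => hne <| by
      rw [← neg_sub x, h0, neg_zero, mul_zero] at hgeom
      rw [← neg_sub, ← hgeom, neg_zero]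
    rw [inv_mul_eq_iff_eq_mul₀ h1]
    linear_combination hgeom
  simp only [hterm, div_mul_eq_mul_div, sum_mul, ← sum_div]
  rw [← mul_div_assoc]
  congr 1
  rw [sum_comm]
  have : ∀ a ∈ range m, ∑ r ∈ range m,
      x ^ (m - 1 - a) * (ζ ^ (a * r) * y ^ a) * (ζ ^ (k * r))⁻¹ =
      if a = b then m * (x ^ (m - 1 - b) * y ^ b) else 0 := fun a ha => by
    have hiff : (a : ZMod m) = k ↔ a = b := by
      rw [← hbk, ZMod.natCast_eq_natCast_iff', Nat.mod_eq_of_lt (mem_range.1 ha),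
        Nat.mod_eq_of_lt hb]
    calc _ = x ^ (m - 1 - a) * y ^ a * ∑ r ∈ range m, ζ ^ (a * r) * (ζ ^ (k * r))⁻¹ := by
          rw [mul_sum]; exact sum_congr rfl fun r _ => by ring
      _ = _ := by
          rw [sum_pow_mul_inv_pow hζ]
          simp only [hiff]
          split_ifs with h
          · rw [h]; ring
          · simp
  rw [sum_congr rfl this, sum_ite_eq' , if_pos (mem_range.2 hb)]

/-- `|λ| = -m c₀₀`. -/
theorem sum_lam {m : ℕ} [NeZero m] {s : rootsOfUnity m ℂ} (hs : IsPrimitiveRoot s m) (c₀₀ : ℂ)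
    (c : {r : ZMod m // r ≠ 0} → ℂ) : ∑ i, lam s c₀₀ c i = -(m : ℂ) * c₀₀ := by
  have hlam : ∀ i, lam s c₀₀ c i = (if i = 0 then -(m : ℂ) * c₀₀ else 0) +
      ∑ r, c r * (((s : ℂˣ) : ℂ) ^ (i.val * r.1.val))⁻¹ := fun i => by
    unfold lam
    split_ifs with h
    · simp [h]
    · simp
  simp only [hlam, sum_add_distrib, sum_ite_eq', mem_univ, if_true]
  rw [sum_comm, sum_eq_zero, add_zero]
  intro r _
  rw [← mul_sum, sum_zmod_eq_sum_range]
  have h := sum_pow_mul_inv_pow (isPrimitiveRoot_coe hs) 0 r.1.val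
  rw [if_neg (by simpa using r.2.symm)] at h
  refine mul_eq_zero_of_right _ (Eq.trans (sum_congr rfl fun i hi => ?_) h)
  rw [ZMod.val_cast_of_lt (mem_range.1 hi), zero_mul, pow_zero, one_mul, mul_comm]

/-- The values of `∑ c_r s^r` at the characters of `Γ` are the differences of the `κ_k`, since the
`k`-th character is `1` on `ε_k` and `0` on the other idempotents. -/
theorem sum_character_eq {m : ℕ} [NeZero m] {s : rootsOfUnity m ℂ} (hs : IsPrimitiveRoot s m)
    {c : {r : ZMod m // r ≠ 0} → ℂ} {κ : ZMod m → ℂ}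
    (hκ : ∑ r, MonoidAlgebra.single (s ^ r.1.val) (c r) =
      ∑ l : ZMod m, ((m : ℂ) * (κ l - κ (l - 1))) • idempotent s l) (k : ℕ) :
    ∑ r, c r * ((s : ℂˣ) : ℂ) ^ (k * r.1.val) = m * (κ k - κ (k - 1)) := by
  have hm : (m : ℂ) ≠ 0 := NeZero.ne _
  have h := congrArg (MonoidAlgebra.lift ℂ ℂ (rootsOfUnity m ℂ)
    ((powMonoidHom k).comp ((Units.coeHom ℂ).comp (rootsOfUnity m ℂ).subtype))) hκ
  simp only [idempotent, map_sum, map_smul, MonoidAlgebra.lift_single, MonoidHom.comp_apply,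
    powMonoidHom_apply, Units.coeHom_apply, Subgroup.subtype_apply, smul_eq_mul,
    SubgroupClass.coe_pow, Units.val_pow_eq_pow_val, ← pow_mul, mul_assoc, ← mul_sum] at h
  simp only [mul_comm k]
  rw [h, sum_eq_single (k : ZMod m)]
  · have h1 := sum_pow_mul_inv_pow (isPrimitiveRoot_coe hs) k (k : ZMod m).val
    rw [if_pos (by simp)] at h1
    simp only [mul_comm k] at h1
    simp only [mul_comm (_⁻¹), h1]
    field_simp
  · intro l _ hl
    have h1 := sum_pow_mul_inv_pow (isPrimitiveRoot_coe hs) k l.val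
    rw [if_neg (by simpa using hl.symm)] at h1
    simp only [mul_comm k] at h1
    simp only [mul_comm (_⁻¹), h1]
    simp
  · simp

/-- `a + λ_0 + ⋯ + λ_t = -m κ_{-t-1}`: the normalisation of `κ_{m-1}` is the case `t = 0`, and
`λ_t = m (κ_{-t} - κ_{-t-1})` for `1 ≤ t < m`. -/
theorem shift_add_sum_lam {m : ℕ} [NeZero m] {s : rootsOfUnity m ℂ} (hs : IsPrimitiveRoot s m)
    {c₀₀ : ℂ} {c : {r : ZMod m // r ≠ 0} → ℂ} {κ : ZMod m → ℂ}
    (hκ : ∑ r, MonoidAlgebra.single (s ^ r.1.val) (c r) =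
      ∑ l : ZMod m, ((m : ℂ) * (κ l - κ (l - 1))) • idempotent s l)
    (hκ' : κ ((m - 1 : ℕ) : ZMod m) =
      ∑ r ∈ Ico 1 m, (((m : ℂ) - r) / (m : ℂ) ^ 2) * lam s c₀₀ c r)
    {t : ℕ} (ht : t < m) :
    shift (lam s c₀₀ c) + ∑ r ∈ range (t + 1), lam s c₀₀ c r =
      -(m : ℂ) * κ (-((t + 1 : ℕ) : ZMod m)) := by
  have hm : (m : ℂ) ≠ 0 := NeZero.ne _
  induction t with
  | zero =>
    have h1 : -((0 + 1 : ℕ) : ZMod m) = ((m - 1 : ℕ) : ZMod m) := by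
      rw [Nat.cast_sub (Nat.one_le_iff_ne_zero.2 (NeZero.ne m))]; simp
    rw [h1, hκ', shift, range_eq_Ico, sum_eq_sum_Ico_succ_bot ht, mul_sum]
    have h2 : ∑ r ∈ Ico (0 + 1) m, ((m : ℂ) - r) / m * lam s c₀₀ c r =
        -∑ r ∈ Ico 1 m, -(m : ℂ) * (((m : ℂ) - r) / (m : ℂ) ^ 2 * lam s c₀₀ c r) := by
      rw [← sum_neg_distrib]
      exact sum_congr rfl fun r _ => by field_simp
    rw [h2]
    simp [hm]
  | succ t ih =>
    rw [sum_range_succ, ← add_assoc, ih (by omega)]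
    have hval : (((t + 1 : ℕ)) : ZMod m).val = t + 1 := ZMod.val_cast_of_lt ht
    have hne : ((t + 1 : ℕ) : ZMod m) ≠ 0 := fun h0 => by
      rw [h0, ZMod.val_zero] at hval; omega
    have hk : ((m - (t + 1) : ℕ) : ZMod m) = -((t + 1 : ℕ) : ZMod m) := by
      rw [Nat.cast_sub ht.le]; simp
    have hd := sum_character_eq hs hκ (m - (t + 1))
    rw [hk] at hd
    have hl : lam s c₀₀ c ((t + 1 : ℕ) : ZMod m) =
        ∑ r, c r * ((s : ℂˣ) : ℂ) ^ ((m - (t + 1)) * r.1.val) := by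
      rw [lam, if_neg hne, hval]
      refine Fintype.sum_congr _ _ fun r => ?_
      congr 1
      refine inv_eq_of_mul_eq_one_right ?_
      rw [← pow_add, ← add_mul, Nat.add_sub_cancel' ht.le, pow_mul, rootsOfUnity_coe_pow, one_pow]
    have h2 : -((t + 1 : ℕ) : ZMod m) - 1 = -((t + 1 + 1 : ℕ) : ZMod m) := by
      push_cast; ring
    rw [hl, hd, h2]
    ring

/-! ### Reflections and evaluation of functions -/

variable {n m : ℕ}

theorem reflection_pow (s : rootsOfUnity m ℂ) (i : Fin n) (r : ℕ) :
    reflection s i ^ r = reflection (s ^ r) i := by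
  rw [reflection, reflection, ← map_pow, Pi.mulSingle_pow]

theorem left_reflection_inv (s : rootsOfUnity m ℂ) (i : Fin n) :
    ((reflection s i)⁻¹).left i = s⁻¹ := by
  rw [reflection, ← map_inv, SemidirectProduct.left_inl, Pi.inv_apply, Pi.mulSingle_eq_same]

theorem right_reflection_inv (s : rootsOfUnity m ℂ) (i : Fin n) :
    ((reflection s i)⁻¹).right = 1 := by
  rw [reflection, ← map_inv, SemidirectProduct.right_inl]

theorem right_conj_transposition_inv (s : rootsOfUnity m ℂ) (i j : Fin n) :
    ((reflection s i * transposition i j * (reflection s i)⁻¹)⁻¹).right = Equiv.swap i j := by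
  simp [reflection, transposition]

theorem left_conj_transposition_inv (s : rootsOfUnity m ℂ) {i j : Fin n} (h : i ≠ j) :
    ((reflection s i * transposition i j * (reflection s i)⁻¹)⁻¹).left i = s := by
  have ht : (transposition i j : WreathGroup n m)⁻¹ = transposition i j := by
    rw [transposition, ← map_inv, Equiv.swap_inv]
  rw [_root_.mul_inv_rev, _root_.mul_inv_rev, inv_inv, ht, reflection, ← map_inv, transposition]
  change (Pi.mulSingle i s : Fin n → rootsOfUnity m ℂ) i * (1 *
    (Pi.mulSingle i s : Fin n → rootsOfUnity m ℂ)⁻¹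
      ((Equiv.swap i j)⁻¹ ((1 : Equiv.Perm (Fin n))⁻¹ i))) = s
  simp [h.symm]

/-- The value at `z` as a linear functional on `ℂ[𝔥_reg × 𝔥^*]`. -/
def evalAt (z : PhaseSpace n m) : regularFunctions n m →ₗ[ℂ] ℂ where
  toFun f := f.1 z
  map_add' _ _ := rfl
  map_smul' _ _ := rfl

theorem evalAt_mul (z : PhaseSpace n m) (f h : regularFunctions n m) :
    evalAt z (f * h) = evalAt z f * evalAt z h := rfl

theorem evalAt_smul_grp (z : PhaseSpace n m) (g : WreathGroup n m) (f : regularFunctions n m) :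
    evalAt z (g • f) = evalAt (g⁻¹ • z) f := rfl

/-! ### The action of the crossed product on functions -/

variable [NeZero m]

/-- The action of the crossed product on `ℂ[𝔥_reg × 𝔥^*]` in which functions act by
multiplication and group elements by translation, as a function of the operator. -/
def actOn (f : regularFunctions n m) : CrossedProduct n m →ₗ[ℂ] regularFunctions n m where
  toFun B := ∑ g : WreathGroup n m, B.coeff g * g • f
  map_add' A B := by
    simp only [SkewMonoidAlgebra.coeff_add, Finsupp.add_apply, add_mul, sum_add_distrib]
  map_smul' c B := by
    simp only [SkewMonoidAlgebra.coeff_smul, Finsupp.smul_apply, smul_mul_assoc, smul_sum,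
      RingHom.id_apply]

theorem actOn_single (f a : regularFunctions n m) (g : WreathGroup n m) :
    actOn f (SkewMonoidAlgebra.single g a) = a * g • f := by
  classical
  change ∑ h : WreathGroup n m, (SkewMonoidAlgebra.single g a).coeff h * h • f = _
  rw [sum_eq_single g]
  · rw [SkewMonoidAlgebra.coeff_single, Finsupp.single_eq_same]
  · intro h _ hh
    rw [SkewMonoidAlgebra.coeff_single, Finsupp.single_eq_of_ne hh, zero_mul]
  · simp

theorem forgetGroup_eq_actOn_one (B : CrossedProduct n m) : forgetGroup B = actOn 1 B := by
  change _ = ∑ g : WreathGroup n m, B.coeff g * g • (1 : regularFunctions n m)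
  simp only [smul_one, mul_one, forgetGroup]

theorem actOn_mul (f : regularFunctions n m) (A B : CrossedProduct n m) :
    actOn f (A * B) = actOn (actOn f B) A := by
  induction A using SkewMonoidAlgebra.induction_on with
  | zero => simp
  | add A₁ A₂ h₁ h₂ => rw [add_mul, map_add, map_add, h₁, h₂]
  | single g a =>
    rw [actOn_single]
    induction B using SkewMonoidAlgebra.induction_on with
    | zero => simp
    | add B₁ B₂ h₁ h₂ => rw [mul_add, map_add, map_add, h₁, h₂, smul_add, mul_add]
    | single h b =>
      rw [SkewMonoidAlgebra.single_mul_single, actOn_single, actOn_single, smul_mul', mul_smul,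
        mul_assoc]

theorem actOn_ofGrp (f : regularFunctions n m) (g : WreathGroup n m) :
    actOn f (ofGrp g) = g • f := by
  rw [ofGrp, actOn_single, one_mul]

theorem actOn_ofFun (f a : regularFunctions n m) : actOn f (ofFun a) = a * f := by
  rw [ofFun, actOn_single, one_smul]

theorem evalAt_actOn_dunkl (s : rootsOfUnity m ℂ) (c₀₀ : ℂ) (κ : ZMod m → ℂ) (i : Fin n)
    (f : regularFunctions n m) (z : PhaseSpace n m) :
    evalAt z (actOn f (dunkl s c₀₀ κ i)) =
      z.p i * evalAt z f
      - c₀₀ * ∑ j : {j : Fin n // i ≠ j}, ∑ r ∈ range m,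
        (z.x i - ((s : ℂˣ) : ℂ) ^ r * z.x j)⁻¹ * evalAt ((reflection s i ^ r *
          transposition i j.1 * (reflection s i ^ r)⁻¹)⁻¹ • z) f
      - (z.x i)⁻¹ * ∑ l : ZMod m, (m * κ l) * ∑ r ∈ range m,
        (1 / (m : ℂ) * (((s : ℂˣ) : ℂ) ^ (l.val * r))⁻¹) *
          evalAt ((reflection s i ^ r)⁻¹ • z) f := by
  simp only [dunkl, idempotentAt, map_sub, map_smul, map_sum, actOn_mul, actOn_ofGrp, actOn_ofFun,
    evalAt_mul, evalAt_smul_grp, smul_eq_mul]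
  rfl

/-- The Hamiltonian is the average over `G` of `∑_i D_i^{jm} · 1`. -/
theorem evalAt_hamiltonian (s : rootsOfUnity m ℂ) (c₀₀ : ℂ) (κ : ZMod m → ℂ) (j : ℕ)
    (z : PhaseSpace n m) :
    evalAt z (hamiltonian s c₀₀ κ j) =
      1 / (Fintype.card (WreathGroup n m) : ℂ) * ∑ g : WreathGroup n m,
        ∑ i : Fin n, evalAt (g⁻¹ • z) (actOn 1 (dunkl s c₀₀ κ i ^ (j * m))) := by
  have hone : actOn (1 : regularFunctions n m) symmetriser = 1 := by
    simp only [symmetriser, map_smul, map_sum, actOn_ofGrp, smul_one, sum_const, card_univ]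
    have : (Fintype.card (WreathGroup n m) : ℂ) ≠ 0 := Nat.cast_ne_zero.2 Fintype.card_ne_zero
    rw [← Nat.cast_smul_eq_nsmul ℂ, smul_smul, one_div, inv_mul_cancel₀ this, one_smul]
  rw [hamiltonian, forgetGroup_eq_actOn_one, actOn_mul, hone, actOn_mul]
  simp only [symmetriser, map_smul, map_sum, actOn_ofGrp, evalAt_smul_grp, smul_eq_mul]

/-! ### The slice matrix -/

theorem sliceMatrix_apply (lam : ZMod m → ℂ) (ν μ : Fin n → ℂ) (a b : ZMod m × Fin n) :
    sliceMatrix lam ν μ a b =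
      if b.1 = a.1 + 1 then sliceBlock lam ν μ a.1 a.2 b.2 else 0 := by
  rw [sliceMatrix, Matrix.sum_apply, sum_eq_single a.1]
  · simp
  · intro i _ hi
    simp [hi.symm]
  · simp

/-- The vector `(1, …, 1)` in the summand `V_0`. -/
def framing (n m : ℕ) : ZMod m × Fin n → ℂ := fun a => if a.1 = 0 then 1 else 0

/-- The vector `Y_{-k} ⋯ Y_{-2} Y_{-1} (1, …, 1)`, with indices modulo `m`, in the summand
`V_{-k}`. -/
def blockVector (lam : ZMod m → ℂ) (ν μ : Fin n → ℂ) : ℕ → Fin n → ℂ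
  | 0 => 1
  | k + 1 => sliceBlock lam ν μ (-((k + 1 : ℕ) : ZMod m)) *ᵥ blockVector lam ν μ k

theorem sliceMatrix_pow_mulVec_framing (lam : ZMod m → ℂ) (ν μ : Fin n → ℂ) (k : ℕ)
    (a : ZMod m × Fin n) :
    (sliceMatrix lam ν μ ^ k *ᵥ framing n m) a =
      if a.1 = -(k : ZMod m) then blockVector lam ν μ k a.2 else 0 := by
  induction k generalizing a with
  | zero => simp [framing, blockVector]
  | succ k ih =>
    rw [pow_succ', ← mulVec_mulVec, mulVec, dotProduct]
    simp only [ih, sliceMatrix_apply, Fintype.sum_prod_type]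
    rw [sum_eq_single (a.1 + 1)]
    · have h : a.1 + 1 = -(k : ZMod m) ↔ a.1 = -((k + 1 : ℕ) : ZMod m) := by
        push_cast
        constructor <;> intro h
        · rw [eq_sub_of_add_eq h]; ring
        · rw [h]; ring
      simp only [if_true, h]
      split_ifs with h1
      · rw [blockVector, mulVec, dotProduct, h1]
      · simp
    · intro b _ hb
      simp [hb]
    · simp

/-- The matrix `X` of the slice: it maps `V_i` to `V_{i+1}` by `diag(ν_1, …, ν_n)`. -/
def positionMatrix (m : ℕ) (ν : Fin n → ℂ) : Matrix (ZMod m × Fin n) (ZMod m × Fin n) ℂ :=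
  Matrix.of fun a b => if b = (a.1 - 1, a.2) then ν a.2 else 0

theorem mul_sliceBlock_sub (lam : ZMod m → ℂ) {ν : Fin n → ℂ} (μ : Fin n → ℂ)
    (hν : ν ∈ regularSet n m) (i : ZMod m) (j k : Fin n) :
    ν j * sliceBlock lam ν μ (i - 1) j k - sliceBlock lam ν μ i j k * ν k =
      (if i = 0 then ∑ r, lam r else 0) - if j = k then lam i else 0 := by
  have h0 := hν.1
  by_cases hi : i = 0
  · subst hi
    have hval : (0 - 1 : ZMod m).val = m - 1 := by
      obtain ⟨k, rfl⟩ := Nat.exists_eq_succ_of_ne_zero (NeZero.ne m)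
      rw [zero_sub, ZMod.val_neg_one]; rfl
    have hm : m - 1 + 1 = m := Nat.succ_pred_eq_of_ne_zero (NeZero.ne m)
    simp only [sliceBlock, of_apply, hval, ZMod.val_zero, hm, if_true]
    by_cases hjk : j = k
    · subst hjk
      have := h0 j
      simp only [if_true, zero_add, sum_range_one, Nat.cast_zero, sum_zmod_eq_sum_range lam]
      field_simp
      ring
    · have := sub_ne_zero.2 (hν.2 j k hjk)
      simp only [hjk, if_false]
      have e1 : ν j ^ m = ν j ^ (m - 1) * ν j := by rw [← pow_succ, hm]
      have e2 : ν k ^ m = ν k ^ (m - 1) * ν k := by rw [← pow_succ, hm]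
      have e3 : m - (m - 1) - 1 = 0 := by omega
      rw [e3, Nat.sub_zero]
      rw [pow_zero, pow_zero, mul_one, one_mul]
      field_simp
      rw [e1, e2]
      ring
  · obtain ⟨t, ht⟩ : ∃ t, i.val = t + 1 := Nat.exists_eq_succ_of_ne_zero (by simpa using hi)
    have htm : t + 1 < m := ht ▸ i.val_lt
    have hit : i = ((t + 1 : ℕ) : ZMod m) := by rw [← ht, ZMod.natCast_zmod_val]
    have hval : (i - 1).val = t := by
      rw [hit, Nat.cast_succ, add_sub_cancel_right, ZMod.val_cast_of_lt (by omega)]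
    simp only [sliceBlock, of_apply, hval, ht, hi, if_false]
    by_cases hjk : j = k
    · subst hjk
      have := h0 j
      rw [sum_range_succ _ (t + 1), ← hit]
      simp only [if_true]
      field_simp
      ring
    · have := sub_ne_zero.2 (hν.2 j k hjk)
      have e1 : m - t - 1 = (m - (t + 1) - 1) + 1 := by omega
      simp only [hjk, if_false, e1]
      ring

/-- The moment map equation `[X, Y] = |λ| v vᵀ - ∑_i λ_i Id_{V_i}`. -/
theorem commutator_eq (lam : ZMod m → ℂ) {ν : Fin n → ℂ} (μ : Fin n → ℂ)
    (hν : ν ∈ regularSet n m) :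
    positionMatrix m ν * sliceMatrix lam ν μ - sliceMatrix lam ν μ * positionMatrix m ν =
      (∑ r, lam r) • vecMulVec (framing n m) (framing n m) - diagonal fun a => lam a.1 := by
  ext a b
  have h1 : (positionMatrix m ν * sliceMatrix lam ν μ) a b =
      if a.1 = b.1 then ν a.2 * sliceBlock lam ν μ (a.1 - 1) a.2 b.2 else 0 := by
    rw [Matrix.mul_apply, sum_eq_single (a.1 - 1, a.2)]
    · simp [positionMatrix, sliceMatrix_apply, eq_comm]
    · intro d _ hd
      simp [positionMatrix, hd]
    · simp
  have h2 : (sliceMatrix lam ν μ * positionMatrix m ν) a b =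
      if a.1 = b.1 then sliceBlock lam ν μ a.1 a.2 b.2 * ν b.2 else 0 := by
    rw [Matrix.mul_apply, sum_eq_single (b.1 + 1, b.2)]
    · by_cases h : a.1 = b.1
      · simp [positionMatrix, sliceMatrix_apply, h]
      · simp [sliceMatrix_apply, h, Ne.symm h]
    · intro d _ hd
      have : b ≠ (d.1 - 1, d.2) := fun h => hd (by rw [h]; simp)
      simp [positionMatrix, this]
    · simp
  simp only [Matrix.sub_apply, h1, h2, Matrix.smul_apply, vecMulVec_apply, framing, diagonal_apply,
    Prod.ext_iff, smul_eq_mul]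
  by_cases h : a.1 = b.1
  · simp only [h, if_true, true_and]
    rw [← h, mul_sliceBlock_sub lam μ hν]
    by_cases ha : a.1 = 0 <;> simp [ha]
  · have : ¬ (a.1 = 0 ∧ b.1 = 0) := fun h' => h (h'.1.trans h'.2.symm)
    simp only [h, if_false, false_and, sub_zero]
    by_cases ha : a.1 = 0
    · have hb : b.1 ≠ 0 := fun hb => this ⟨ha, hb⟩
      simp [hb]
    · simp [ha]

/-- The trace of the diagonal block of `Y^N` at `V_a` does not depend on `a`. -/
theorem sum_sliceMatrix_pow_apply (lam : ZMod m → ℂ) (ν μ : Fin n → ℂ) (N : ℕ) (a : ZMod m) :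
    ∑ i, (sliceMatrix lam ν μ ^ N) (a, i) (a, i) =
      (1 / (m : ℂ)) * (sliceMatrix lam ν μ ^ N).trace := by
  have hm : (m : ℂ) ≠ 0 := NeZero.ne _
  set Y := sliceMatrix lam ν μ
  let E : ZMod m → Matrix (ZMod m × Fin n) (ZMod m × Fin n) ℂ := fun a =>
    diagonal fun b => if b.1 = a then 1 else 0
  have hE : ∀ (a : ZMod m) (M : Matrix (ZMod m × Fin n) (ZMod m × Fin n) ℂ),
      ∑ i, M (a, i) (a, i) = (E a * M).trace := fun a M => by
    simp only [Matrix.trace, E, diag_apply, diagonal_mul, Fintype.sum_prod_type]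
    rw [sum_eq_single a]
    · simp
    · intro b _ hb
      simp [hb]
    · simp
  have hcomm : ∀ a, E a * Y = Y * E (a + 1) := fun a => by
    ext b d
    simp only [E, diagonal_mul, mul_diagonal, Y, sliceMatrix_apply]
    by_cases h : d.1 = b.1 + 1
    · simp [h]
    · simp [h]
  have hstep : ∀ a, ∑ i, (Y ^ N) (a + 1, i) (a + 1, i) = ∑ i, (Y ^ N) (a, i) (a, i) := fun a => by
    -- One factor `Y` is moved around the trace.
    cases N with
    | zero => simp
    | succ N =>
      rw [hE, hE, pow_succ', ← mul_assoc (E a), hcomm, mul_assoc, Matrix.trace_mul_comm Y, mul_assoc,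
        ← pow_succ, ← pow_succ']
  have hconst : ∀ k : ℕ, ∑ i, (Y ^ N) ((k : ZMod m), i) ((k : ZMod m), i) =
      ∑ i, (Y ^ N) (0, i) (0, i) := fun k => by
    induction k with
    | zero => simp
    | succ k ih => rw [Nat.cast_succ, hstep, ih]
  have hall : ∀ b : ZMod m, ∑ i, (Y ^ N) (b, i) (b, i) = ∑ i, (Y ^ N) (0, i) (0, i) := fun b => by
    rw [← hconst b.val, ZMod.natCast_zmod_val]
  have htr : (Y ^ N).trace = ∑ b : ZMod m, ∑ i, (Y ^ N) (b, i) (b, i) := by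
    simp only [Matrix.trace, diag_apply, Fintype.sum_prod_type]
  rw [htr, sum_congr rfl fun b _ => hall b, hall a]
  simp [ZMod.card, hm]

/-- `(1/m) tr Y^N = vᵀ Y^N v`, where `v` is the framing vector. Since `tr (Y^N [X, Y]) = 0`, the
moment map equation gives `|λ| vᵀ Y^N v = ∑_a λ_a T_a`, where `T_a = (1/m) tr Y^N` is the trace of
the diagonal block of `Y^N` at `V_a`. If `|λ| = 0`, the blocks of `Y` are diagonal and the two sides agree term by
term. -/
theorem trace_sliceMatrix_pow (lam : ZMod m → ℂ) {ν : Fin n → ℂ} (μ : Fin n → ℂ)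
    (hν : ν ∈ regularSet n m) (N : ℕ) :
    (1 / (m : ℂ)) * (sliceMatrix lam ν μ ^ N).trace =
      framing n m ⬝ᵥ (sliceMatrix lam ν μ ^ N *ᵥ framing n m) := by
  set Y := sliceMatrix lam ν μ with hY
  by_cases hlam : ∑ r, lam r = 0
  · have hdiag : ∀ N, ∀ a b : ZMod m × Fin n, a.2 ≠ b.2 → (Y ^ N) a b = 0 := fun N => by
      induction N with
      | zero =>
        intro a b h
        rw [pow_zero, Matrix.one_apply_ne fun e => h (congrArg Prod.snd e)]
      | succ N ih =>
        intro a b h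
        rw [pow_succ, Matrix.mul_apply]
        refine sum_eq_zero fun d _ => ?_
        by_cases had : a.2 = d.2
        · have hdb : d.2 ≠ b.2 := fun e => h (had.trans e)
          have hYdb : Y d b = 0 := by
            rw [hY, sliceMatrix_apply, sliceBlock, of_apply, if_neg hdb, hlam, zero_mul, ite_self]
          rw [hYdb, mul_zero]
        · rw [ih a d had, zero_mul]
    rw [← sum_sliceMatrix_pow_apply lam ν μ N 0, ← hY]
    simp only [dotProduct, mulVec, framing, Fintype.sum_prod_type, mul_ite, mul_one, mul_zero]
    simp only [ite_mul, one_mul, zero_mul]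
    rw [sum_eq_single (0 : ZMod m) (fun b _ hb => by simp [hb]) (by simp)]
    refine sum_congr rfl fun i _ => ?_
    rw [if_pos rfl, sum_eq_single (0 : ZMod m) (fun b _ hb => by simp [hb]) (by simp),
      sum_eq_single i (fun j _ hj => by rw [if_pos rfl, hdiag N _ _ hj.symm]) (by simp), if_pos rfl]
  · have h0 : (Y ^ N * (positionMatrix m ν * Y - Y * positionMatrix m ν)).trace = 0 := by
      rw [mul_sub, Matrix.trace_sub, ← mul_assoc, Matrix.trace_mul_comm _ Y, ← mul_assoc,
        ← mul_assoc, ← pow_succ, ← pow_succ', sub_self]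
    rw [commutator_eq lam μ hν, mul_sub, Matrix.trace_sub, mul_smul_comm, Matrix.trace_smul,
      mul_vecMulVec, trace_vecMulVec, dotProduct_comm, smul_eq_mul, sub_eq_zero] at h0
    refine mul_left_cancel₀ hlam (Eq.trans ?_ h0.symm)
    simp only [Matrix.trace, diag_apply, mul_diagonal, Fintype.sum_prod_type, ← sum_mul]
    rw [sum_mul]
    refine sum_congr rfl fun a _ => ?_
    rw [sum_sliceMatrix_pow_apply lam ν μ N a]
    simp only [Matrix.trace, diag_apply, Fintype.sum_prod_type, mul_comm, hY]

/-- The traces of the powers of `Y` in terms of products of the blocks `Y_i`. -/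
theorem trace_sliceMatrix_pow_mul (lam : ZMod m → ℂ) {ν : Fin n → ℂ} (μ : Fin n → ℂ)
    (hν : ν ∈ regularSet n m) (j : ℕ) :
    (1 / (m : ℂ)) * (sliceMatrix lam ν μ ^ (j * m)).trace =
      ∑ i, blockVector lam ν μ (j * m) i := by
  rw [trace_sliceMatrix_pow lam μ hν, dotProduct]
  simp only [sliceMatrix_pow_mulVec_framing, Fintype.sum_prod_type, framing]
  rw [sum_eq_single 0 (fun b _ hb => by simp [hb]) (by simp)]
  simp

/-! ### The Dunkl operators and the slice -/

/-- If `b` is the residue of `k` modulo `m`, then the residue of `-k-1` is `m-1-b`. -/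
theorem val_neg_succ (k : ℕ) :
    ∃ b, b < m ∧ (b : ZMod m) = k ∧ (-((k + 1 : ℕ) : ZMod m)).val = m - 1 - b := by
  have hm := NeZero.pos m
  have hk := Nat.mod_lt k hm
  refine ⟨k % m, hk, by simp, ?_⟩
  have : -((k + 1 : ℕ) : ZMod m) = ((m - 1 - k % m : ℕ) : ZMod m) := by
    rw [Nat.sub_sub, Nat.cast_sub (by omega)]
    simp [add_comm]
  rw [this, ZMod.val_cast_of_lt (by omega)]

/-- The entries of `Y_{-k-1}` have degree `-k-1` in the index of the row and degree `k` in the index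
of the column. -/
theorem sliceBlock_smul (lam : ZMod m → ℂ) (g : WreathGroup n m) (z : PhaseSpace n m) (k : ℕ)
    (i j : Fin n) :
    sliceBlock lam (g • z).x (g • z).p (-((k + 1 : ℕ) : ZMod m)) i j =
      (((g.left i : ℂˣ) : ℂ) ^ (k + 1))⁻¹ * ((g.left j : ℂˣ) : ℂ) ^ k *
        sliceBlock lam z.x z.p (-((k + 1 : ℕ) : ZMod m)) (g.right⁻¹ i) (g.right⁻¹ j) := by
  obtain ⟨b, hb, hbk, hval⟩ := val_neg_succ (m := m) k
  have hm := NeZero.pos m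
  simp only [sliceBlock, of_apply, hval, smul_x, smul_p, EmbeddingLike.apply_eq_iff_eq]
  set u := ((g.left i : ℂˣ) : ℂ)
  set v := ((g.left j : ℂˣ) : ℂ)
  have hu0 : u ≠ 0 := Units.ne_zero _
  have hv0 : v ≠ 0 := Units.ne_zero _
  have hum : u ^ m = 1 := rootsOfUnity_coe_pow _
  have hvm : v ^ m = 1 := rootsOfUnity_coe_pow _
  split_ifs with hij
  · subst hij
    change u⁻¹ * _ + 1 / (u * _) * _ = (u ^ (k + 1))⁻¹ * u ^ k * _
    field_simp
    ring
  · have e1 : u ^ (m - 1 - b) = (u ^ (k + 1))⁻¹ := by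
      refine eq_inv_of_mul_eq_one_left ?_
      rw [← pow_add, ← pow_zero u]
      refine pow_eq_pow_of_cast_eq hum ?_
      rw [← hval]
      simp
    have e2 : v ^ (m - (m - 1 - b) - 1) = v ^ k := by
      refine pow_eq_pow_of_cast_eq hvm ?_
      rw [show m - (m - 1 - b) - 1 = b by omega, hbk]
    simp only [mul_pow, e1, e2, hum, hvm, one_mul]
    ring

/-- Under `G`, the vector `Y_{-k} ⋯ Y_{-1} (1, …, 1)` is permuted and its entries are
multiplied by the `(-k)`-th power of the character of `Γ`. -/
theorem blockVector_smul (lam : ZMod m → ℂ) (g : WreathGroup n m) (z : PhaseSpace n m) (k : ℕ)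
    (i : Fin n) :
    blockVector lam (g • z).x (g • z).p k i =
      (((g.left i : ℂˣ) : ℂ) ^ k)⁻¹ * blockVector lam z.x z.p k (g.right⁻¹ i) := by
  induction k generalizing i with
  | zero => simp [blockVector]
  | succ k ih =>
    simp only [blockVector, mulVec, dotProduct, ih, sliceBlock_smul]
    rw [mul_sum, ← Equiv.sum_comp g.right⁻¹ fun l => (((g.left i : ℂˣ) : ℂ) ^ (k + 1))⁻¹ *
      (sliceBlock lam z.x z.p (-((k + 1 : ℕ) : ZMod m)) (g.right⁻¹ i) l *
        blockVector lam z.x z.p k l)]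
    refine sum_congr rfl fun l _ => ?_
    have : ((g.left l : ℂˣ) : ℂ) ≠ 0 := Units.ne_zero _
    field_simp

/-- The function `D_i^k · 1` is the `i`-th entry of `Y_{-k} ⋯ Y_{-1} (1, …, 1)`. By the equivariance
of these vectors, `s_i` multiplies `D_i^k · 1` by `s^k`, and `s_i^r s_{ij} s_i^{-r}` sends it to
`s^{-rk} D_j^k · 1`; so `D_i` acts through the `i`-th row of an `n × n` matrix of functions, which
is `Y_{-k-1}`. -/
theorem evalAt_actOn_dunkl_pow {s : rootsOfUnity m ℂ} (hs : IsPrimitiveRoot s m) {c₀₀ : ℂ}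
    {c : {r : ZMod m // r ≠ 0} → ℂ} {κ : ZMod m → ℂ}
    (hκ : ∑ r, MonoidAlgebra.single (s ^ r.1.val) (c r) =
      ∑ l : ZMod m, ((m : ℂ) * (κ l - κ (l - 1))) • idempotent s l)
    (hκ' : κ ((m - 1 : ℕ) : ZMod m) =
      ∑ r ∈ Ico 1 m, (((m : ℂ) - r) / (m : ℂ) ^ 2) * lam s c₀₀ c r)
    (i : Fin n) (k : ℕ) (z : PhaseSpace n m) :
    evalAt z (actOn 1 (dunkl s c₀₀ κ i ^ k)) = blockVector (lam s c₀₀ c) z.x z.p k i := by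
  induction k generalizing z with
  | zero =>
    rw [pow_zero, SkewMonoidAlgebra.one_def, actOn_single, one_smul, one_mul]
    rfl
  | succ k ih =>
    have hζ := isPrimitiveRoot_coe hs
    obtain ⟨b, hb, hbk, hval⟩ := val_neg_succ (m := m) k
    set ζ := ((s : ℂˣ) : ℂ) with hζdef
    set W := blockVector (lam s c₀₀ c) z.x z.p k with hW
    have hrefl : ∀ r : ℕ, evalAt ((reflection s i ^ r)⁻¹ • z) (actOn 1 (dunkl s c₀₀ κ i ^ k)) =
        ζ ^ (k * r) * W i := fun r => by
      rw [ih, blockVector_smul, reflection_pow, left_reflection_inv, right_reflection_inv]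
      simp [hζdef, hW, ← pow_mul, mul_comm]
    have htrans : ∀ (j : {j : Fin n // i ≠ j}) (r : ℕ),
        evalAt ((reflection s i ^ r * transposition i j.1 * (reflection s i ^ r)⁻¹)⁻¹ • z)
          (actOn 1 (dunkl s c₀₀ κ i ^ k)) = (ζ ^ (k * r))⁻¹ * W j := fun j r => by
      rw [ih, blockVector_smul, reflection_pow, left_conj_transposition_inv _ j.2,
        right_conj_transposition_inv]
      simp [hζdef, hW, ← pow_mul, mul_comm]
    rw [pow_succ', actOn_mul, evalAt_actOn_dunkl]
    simp only [hrefl, htrans, ih, ← hζdef, ← hW]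
    -- `D_i^k · 1` lies in the image of `(ε_k)_i`.
    have hdiag : ∑ l : ZMod m, (m * κ l) * ∑ r ∈ range m,
        (1 / (m : ℂ) * (ζ ^ (l.val * r))⁻¹) * (ζ ^ (k * r) * W i) = m * κ k * W i := by
      have hm : (m : ℂ) ≠ 0 := NeZero.ne _
      have hl : ∀ l : ZMod m, ∑ r ∈ range m,
          (1 / (m : ℂ) * (ζ ^ (l.val * r))⁻¹) * (ζ ^ (k * r) * W i) =
          if (k : ZMod m) = l then W i else 0 := fun l => by
        have h := sum_pow_mul_inv_pow hζ k l.val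
        rw [ZMod.natCast_zmod_val] at h
        calc _ = 1 / (m : ℂ) * W i * ∑ r ∈ range m, ζ ^ (k * r) * (ζ ^ (l.val * r))⁻¹ := by
              rw [mul_sum]; exact sum_congr rfl fun r _ => by ring
          _ = _ := by
              rw [h]
              split_ifs
              · field_simp
              · simp
      simp only [hl, mul_ite, mul_zero, sum_ite_eq, mem_univ, if_true]
    have hoff : ∀ j : {j : Fin n // i ≠ j}, ∑ r ∈ range m,
        (z.x i - ζ ^ r * z.x j)⁻¹ * ((ζ ^ (k * r))⁻¹ * W j) =
        m * (z.x i ^ (m - 1 - b) * z.x j ^ b / (z.x i ^ m - z.x j ^ m)) * W j := fun j => by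
      simp only [← mul_assoc, ← sum_mul]
      rw [sum_inv_sub_mul hζ (z.reg.2 i j j.2) hb hbk, mul_assoc (m : ℂ)]
    have hshift := shift_add_sum_lam (c₀₀ := c₀₀) hs hκ hκ' (t := m - 1 - b) (by omega)
    have hcast : -((m - 1 - b + 1 : ℕ) : ZMod m) = k := by
      rw [show m - 1 - b + 1 = m - b by omega, Nat.cast_sub hb.le]
      simp [hbk]
    rw [hcast] at hshift
    rw [hdiag, blockVector, ← hW, mulVec, dotProduct, ← add_sum_erase _ _ (mem_univ i)]
    simp only [hoff, sliceBlock, of_apply, hval, if_true, hshift]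
    have herase : ∑ j ∈ univ.erase i, (if i = j then z.p i + 1 / z.x i * (-m * κ k) else
          (∑ r, lam s c₀₀ c r) * (z.x i ^ (m - 1 - b) * z.x j ^ (m - (m - 1 - b) - 1) /
            (z.x i ^ m - z.x j ^ m))) * W j =
        -c₀₀ * ∑ j : {j : Fin n // i ≠ j},
          m * (z.x i ^ (m - 1 - b) * z.x j ^ b / (z.x i ^ m - z.x j ^ m)) * W j := by
      rw [sum_lam hs, mul_sum, ← sum_subtype (univ.erase i) (by simp [eq_comm])
        (fun j => -c₀₀ * (m * (z.x i ^ (m - 1 - b) * z.x j ^ b / (z.x i ^ m - z.x j ^ m)) * W j))]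
      refine sum_congr rfl fun j hj => ?_
      rw [if_neg (ne_of_mem_erase hj).symm, show m - (m - 1 - b) - 1 = b by omega]
      ring
    rw [herase]
    ring

end CalogeroMoser

end

theorem mainTheorem4 (n m : ℕ) [NeZero m] (s : rootsOfUnity m ℂ) (hs : IsPrimitiveRoot s m)
    (c₀₀ : ℂ) (c : {r : ZMod m // r ≠ 0} → ℂ) (κ : ZMod m → ℂ)
    (hκ : ∑ r, MonoidAlgebra.single (s ^ r.1.val) (c r) =
      ∑ l : ZMod m, ((m : ℂ) * (κ l - κ (l - 1))) • CalogeroMoser.idempotent s l)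
    (hκ' : κ ((m - 1 : ℕ) : ZMod m) =
      ∑ r ∈ Finset.Ico 1 m, (((m : ℂ) - r) / (m : ℂ) ^ 2) * CalogeroMoser.lam s c₀₀ c r)
    (j : ℕ) (ν μ : Fin n → ℂ) (hν : ν ∈ CalogeroMoser.regularSet n m) :
    (1 / (m : ℂ)) *
        (CalogeroMoser.sliceMatrix (CalogeroMoser.lam s c₀₀ c) ν μ ^ (j * m)).trace =
      (CalogeroMoser.hamiltonian s c₀₀ κ j : CalogeroMoser.regularFunctions n m).1 ⟨ν, μ, hν⟩ := by
  open CalogeroMoser in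
  rw [trace_sliceMatrix_pow_mul _ μ hν]
  change _ = evalAt ⟨ν, μ, hν⟩ (hamiltonian s c₀₀ κ j)
  rw [evalAt_hamiltonian]
  have hinv : ∀ g : WreathGroup n m, ∑ i : Fin n, evalAt (g⁻¹ • ⟨ν, μ, hν⟩)
      (actOn 1 (dunkl s c₀₀ κ i ^ (j * m))) = ∑ i, blockVector (lam s c₀₀ c) ν μ (j * m) i := by
    intro g
    rw [← Equiv.sum_comp (g⁻¹).right⁻¹ fun i => blockVector (lam s c₀₀ c) ν μ (j * m) i]
    refine Finset.sum_congr rfl fun i _ => ?_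
    rw [evalAt_actOn_dunkl_pow hs hκ hκ', blockVector_smul, mul_comm j m, pow_mul _ m,
      rootsOfUnity_coe_pow, one_pow, inv_one, one_mul]
  have hcard : (Fintype.card (WreathGroup n m) : ℂ) ≠ 0 :=
    Nat.cast_ne_zero.2 Fintype.card_ne_zero
  simp only [hinv, Finset.sum_const, Finset.card_univ, nsmul_eq_mul]
  rw [← mul_assoc, one_div, inv_mul_cancel₀ hcard, one_mul]
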